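/- Let $I\subseteq\mathbb R$ be an open interval containing $0$ and let $f,g$ be real analytic on $I$ with $x\,g(x)>0$ for all $x\in I\setminus\{0\}$ and $g'(0)>0$. Consider $$(E)\qquad \ddot x+f(x)\dot x^2+g(x)=0,\qquad\text{i.e.}\qquad \dot x=y,\quad \dot y=-g(x)-f(x)y^2\quad\text{on } I\times\mathbb R .$$ Then the origin is a center of $(E)$: it is an equilibrium, and every other point of some neighborhood of it lies on a cycle (a closed orbit in $I\times\mathbb R$ that is not an equilibrium). Let $F(x)=\int_0^x f(s)\,ds$ and $\phi(x)=\int_0^x e^{F(s)}\,ds$. There are functions $X=X(x)$ on $I$ and $H=H(X)$ on $X(I)$ such that $$\tfrac12X(x)^2=\int_0^x g(s)e^{2F(s)}\,ds,\qquad X(x)\,\phi(x)>0\ \ (x\neq0),\qquad \phi(x)=X(x)+H(X(x))\qquad(x\in I),$$ and for any such $X,H$ the function $H$ is analytic on $X(I)$ and the following holds. For a cycle let $T$ be its minimum period and let $c=\tfrac12X(x)^2+\tfrac12\bigl(e^{F(x)}y\bigr)^2$ at any point $(x,y)$ of it (so $c=\tfrac12X(x)^2$ where the cycle meets the $x$-axis).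 Then for every cycle in $I\times\mathbb R$ one has $[-\sqrt{2c},\sqrt{2c}]\subseteq X(I)$ and $$T=T(c)=2\int_{-\pi/2}^{\pi/2}\Bigl[1+H'\bigl(\sqrt{2c}\,\sin\theta\bigr)\Bigr]\,d\theta .$$ Moreover: (i) if $H'''(0)>0$, then $T$ is strictly increasing in a neighborhood of $0$, that is, there is $\delta>0$ such that every point $(a,0)$ with $0<a<\delta$ lies on a cycle and the minimum period of this cycle is a strictly increasing function of $a\in(0,\delta)$; (ii) if $H'''(0)<0$, then $T$ is strictly decreasing in a neighborhood of $0$, in the same sense; (iii) if the center is isochronous (that is, $T$ is constant on the cycles in a neighborhood of $0$), then $H'''(0)=0$. -/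

import Mathlib

open Set Filter Topology

noncomputable section

namespace LienardType

/-- `F(x) = ∫₀ˣ f(s) ds`. -/
def primF (f : ℝ → ℝ) (x : ℝ) : ℝ := ∫ s in (0 : ℝ)..x, f s

/-- `φ(x) = ∫₀ˣ e^{F(s)} ds`. -/
def phi (f : ℝ → ℝ) (x : ℝ) : ℝ := ∫ s in (0 : ℝ)..x, Real.exp (primF f s)

/-- `γ = (x, y)` is a solution, defined for all times and staying in `I × ℝ`, of the planar system
`x' = y`, `y' = -g(x) - f(x) y²` equivalent to `x'' + f(x) x'² + g(x) = 0`. -/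
structure IsSolution (I : Set ℝ) (f g : ℝ → ℝ) (γ : ℝ → ℝ × ℝ) : Prop where
  mem : ∀ t, (γ t).1 ∈ I
  hasDerivAt : ∀ t, HasDerivAt γ ((γ t).2, -g (γ t).1 - f (γ t).1 * (γ t).2 ^ 2) t

/-- `T` is a positive period (not necessarily the least one) of a solution starting at `p`. -/
def IsPeriodAt (I : Set ℝ) (f g : ℝ → ℝ) (p : ℝ × ℝ) (T : ℝ) : Prop :=
  0 < T ∧ ∃ γ : ℝ → ℝ × ℝ, IsSolution I f g γ ∧ γ 0 = p ∧ Function.Periodic γ T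

/-- `p` is not an equilibrium and the orbit through `p` is closed (a cycle). -/
def OnCycle (I : Set ℝ) (f g : ℝ → ℝ) (p : ℝ × ℝ) : Prop :=
  ¬(p.2 = 0 ∧ g p.1 = 0) ∧ ∃ T, IsPeriodAt I f g p T

/-- The period function: the minimum period of the cycle through `p`. -/
def periodFunction (I : Set ℝ) (f g : ℝ → ℝ) (p : ℝ × ℝ) : ℝ :=
  sInf {T | IsPeriodAt I f g p T}

/-- The origin is a center: it is an equilibrium, and every other orbit in a
neighborhood of it is a cycle. -/
def IsCenter (I : Set ℝ) (f g : ℝ → ℝ) : Prop :=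
  (0 : ℝ) ∈ I ∧ g 0 = 0 ∧ ∀ᶠ p in 𝓝[≠] (0 : ℝ × ℝ), OnCycle I f g p

/-- The origin is an isochronous center: a center with constant period function near it. -/
def IsIsochronousCenter (I : Set ℝ) (f g : ℝ → ℝ) : Prop :=
  IsCenter I f g ∧ ∃ τ : ℝ, ∀ᶠ p in 𝓝[≠] (0 : ℝ × ℝ), periodFunction I f g p = τ

/-- The period function (strictly) increases near the origin; nested cycles
are parametrized by the point `(a, 0)`, `a > 0`, where they cross the positive `x`-axis. -/
def PeriodIncreasesNearZero (I : Set ℝ) (f g : ℝ → ℝ) : Prop :=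
  ∃ δ > 0, (∀ a ∈ Ioo (0 : ℝ) δ, OnCycle I f g (a, 0)) ∧
    StrictMonoOn (fun a : ℝ => periodFunction I f g (a, 0)) (Ioo 0 δ)

/-- The period function (strictly) decreases near the origin. -/
def PeriodDecreasesNearZero (I : Set ℝ) (f g : ℝ → ℝ) : Prop :=
  ∃ δ > 0, (∀ a ∈ Ioo (0 : ℝ) δ, OnCycle I f g (a, 0)) ∧
    StrictAntiOn (fun a : ℝ => periodFunction I f g (a, 0)) (Ioo 0 δ)

/-- The functions `X` (of `x ∈ I`) and `H` (of `X`): `X²/2 = ∫₀ˣ g e^{2F}`, with `X φ(x) > 0` for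
`x ≠ 0`, and `φ(x) = X + H(X)`. -/
structure IsXHPair (I : Set ℝ) (f g X H : ℝ → ℝ) : Prop where
  sq_eq : ∀ x ∈ I, 1 / 2 * X x ^ 2 = ∫ s in (0 : ℝ)..x, g s * Real.exp (2 * primF f s)
  sign : ∀ x ∈ I, x ≠ 0 → 0 < X x * phi f x
  phi_eq : ∀ x ∈ I, phi f x = X x + H (X x)

/-- The constant `c` of an orbit, `c = X(x)²/2 + (e^{F(x)} y)²/2` at any point `(x, y)` of it. For a
motion starting at rest at `x` it is `X(x)²/2`. -/
def level (f X : ℝ → ℝ) (p : ℝ × ℝ) : ℝ :=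
  1 / 2 * X p.1 ^ 2 + 1 / 2 * (Real.exp (primF f p.1) * p.2) ^ 2

end LienardType

end

/-! In the coordinates `u = X(x)`, `w = e^{F(x)} y` the system becomes `u' = w / h(u)`, `w' = -u /
h(u)` with `h = 1 + H'`. Here `h > 0` on `X(I)`, because differentiating `φ = X + H(X)` gives `h(X)
X' = e^F`, and `X' > 0`. So `u² + w² = r² = 2c` is conserved and, writing `u = r sin θ`, `w = r cos
θ`, the angle moves with speed `1 / h(u)`. The time of a full turn is the integral of `h(r sin θ)`
over a period, which the reflection `θ ↦ π - θ` folds to twice the integral over `[-π/2, π/2]`.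

On a periodic orbit the angular speed is bounded below, so the orbit covers its circle and `[-r, r]
⊆ X(I)`. Conversely, every circle of positive radius projecting into `X(I)` carries a cycle; as
`X(I)` is an open neighborhood of 0, the origin is a center. Every solution is integrated explicitly
(`IsCircleFlow.exists_angle`), so no uniqueness theorem for differential equations is needed.

Analyticity of `X` at 0 comes from `∫ g e^{2F} = x² k(x)` with `k` analytic and `k(0) > 0`; `H` is
`φ ∘ X⁻¹ - id`. For (i)–(iii), only the even part of `h` contributes to the period, and it is
strictly increasing in `v ≥ 0` near 0 if `h''(0) = H'''(0) > 0`. -/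

open Set Filter Topology

/-! ### Analytic primitives -/

/-- A real analytic function has an analytic primitive near each point. -/
theorem AnalyticAt.exists_analytic_primitive {f : ℝ → ℝ} {a : ℝ} (hf : AnalyticAt ℝ f a) :
    ∃ P : ℝ → ℝ, AnalyticAt ℝ P a ∧ ∀ᶠ x in 𝓝 a, HasDerivAt P (f x) x := by
  obtain ⟨p, r, hp⟩ := hf
  -- The series integrated term by term. At `n = 0` the division by zero makes the constant term 0.
  let q : FormalMultilinearSeries ℝ ℝ ℝ :=
    FormalMultilinearSeries.ofScalars ℝ (fun n => p.coeff (n - 1) / (n : ℝ))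
  have hqnorm : ∀ n, ‖q n‖ = ‖p.coeff (n - 1) / (n : ℝ)‖ := fun n => by
    simp [q]
  have hrad : p.radius ≤ q.radius := by
    refine ENNReal.le_of_forall_nnreal_lt fun s hs => ?_
    obtain ⟨C, hC, hb⟩ := p.norm_mul_pow_le_of_lt_radius hs
    refine q.le_radius_of_bound (C * s) fun n => ?_
    rcases n with _ | n
    · rw [hqnorm]; simp; positivity
    · rw [hqnorm, pow_succ, ← mul_assoc]
      gcongr
      refine le_trans ?_ (hb n)
      gcongr
      rw [Nat.add_sub_cancel, norm_div, FormalMultilinearSeries.norm_apply_eq_norm_coef]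
      refine div_le_self (norm_nonneg _) ?_
      rw [Real.norm_natCast]
      simp
  have hr : r ≤ q.radius := hp.r_le.trans hrad
  have hq : HasFPowerSeriesOnBall (fun x => q.sum (x - a)) q a r := by
    have := (q.hasFPowerSeriesOnBall (hp.r_pos.trans_le hr)).mono hp.r_pos hr
    simpa using this.comp_sub a
  -- The factor `y` arises from applying the Fréchet derivative to `y`. It cancels only for `y ≠ 0`;
  -- the value at `a` follows by continuity of both sides.
  have key : ∀ y ∈ Metric.eball (0 : ℝ) r,
      deriv (fun x => q.sum (x - a)) (a + y) * y = f (a + y) * y := by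
    intro y hy
    have h1 := (hq.fderiv.hasSum hy).mapL (ContinuousLinearMap.apply ℝ ℝ y)
    simp only [ContinuousLinearMap.apply_apply] at h1
    have h2 := (hp.hasSum hy).mul_right y
    have h3 : ∀ n, q.derivSeries n (fun _ => y) y = p n (fun _ => y) * y := by
      intro n
      rw [FormalMultilinearSeries.derivSeries_apply_diag,
        FormalMultilinearSeries.apply_eq_pow_smul_coeff,
        FormalMultilinearSeries.apply_eq_pow_smul_coeff,
        FormalMultilinearSeries.coeff_ofScalars]
      have : ((n : ℝ) + 1) ≠ 0 := by positivity
      simp only [Nat.add_sub_cancel, smul_eq_mul, nsmul_eq_mul, Nat.cast_add, Nat.cast_one]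
      field_simp
      ring
    simp only [h3] at h1
    rw [h2.unique h1, ← fderiv_apply_one_eq_deriv, mul_comm, ← smul_eq_mul, ← map_smul]
    simp
  have hPa : AnalyticAt ℝ (fun x => q.sum (x - a)) a := hq.analyticAt
  refine ⟨_, hPa, ?_⟩
  have hball : Metric.eball a r ∈ 𝓝 a := Metric.eball_mem_nhds a hp.r_pos
  have hne : ∀ x ∈ Metric.eball a r, x ≠ a → deriv (fun x => q.sum (x - a)) x = f x := by
    intro x hx hxa
    have := key (x - a) (by simpa [Metric.mem_eball, edist_eq_enorm_sub] using hx)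
    rw [add_sub_cancel] at this
    exact mul_right_cancel₀ (sub_ne_zero.2 hxa) this
  have hae : deriv (fun x => q.sum (x - a)) a = f a := by
    have h1 := hPa.deriv.continuousAt.tendsto.mono_left (nhdsWithin_le_nhds (s := {a}ᶜ))
    have h2 := hp.analyticAt.continuousAt.tendsto.mono_left (nhdsWithin_le_nhds (s := {a}ᶜ))
    refine tendsto_nhds_unique (h1.congr' ?_) h2
    filter_upwards [mem_nhdsWithin_of_mem_nhds hball, self_mem_nhdsWithin] with x hx hxa
    exact hne x hx hxa
  filter_upwards [hball, hPa.eventually_analyticAt] with x hx hxan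
  have hd : deriv (fun x => q.sum (x - a)) x = f x := by
    by_cases hxa : x = a
    · rw [hxa, hae]
    · exact hne x hx hxa
  exact hd ▸ hxan.differentiableAt.hasDerivAt

/-- A function with an analytic derivative near a point is analytic there. -/
theorem AnalyticAt.of_hasDerivAt {F f : ℝ → ℝ} {a : ℝ} (hf : AnalyticAt ℝ f a)
    (hF : ∀ᶠ x in 𝓝 a, HasDerivAt F (f x) x) : AnalyticAt ℝ F a := by
  obtain ⟨P, hP, hPd⟩ := hf.exists_analytic_primitive
  obtain ⟨ε, hε, hball⟩ := Metric.eventually_nhds_iff_ball.1 (hF.and hPd)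
  have hconst : ∀ x ∈ Metric.ball a ε, F x - P x = F a - P a := by
    intro x hx
    refine Metric.isOpen_ball.is_const_of_deriv_eq_zero (convex_ball a ε).isPreconnected
      (f := fun x => F x - P x) ?_ ?_ hx (Metric.mem_ball_self hε)
    · intro y hy
      exact ((hball y hy).1.sub (hball y hy).2).differentiableAt.differentiableWithinAt
    · intro y hy
      simpa using! ((hball y hy).1.sub (hball y hy).2).deriv
  refine (hP.add (analyticAt_const (v := F a - P a))).congr ?_
  filter_upwards [Metric.ball_mem_nhds a hε] with x hx
  have := hconst x hx
  simp only [Pi.add_apply]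
  linarith

/-! ### Angles with speed bounded below, and polar coordinates -/

theorem surjective_of_hasDerivAt_ge {θ α : ℝ → ℝ} {m : ℝ} (hd : ∀ t, HasDerivAt θ (α t) t)
    (hm : 0 < m) (hα : ∀ t, m ≤ α t) : Function.Surjective θ := by
  have hmono : Monotone fun t => θ t - m * t := by
    refine monotone_of_deriv_nonneg
      (fun t => ((hd t).sub ((hasDerivAt_id t).const_mul m)).differentiableAt) fun t => ?_
    have := ((hd t).sub ((hasDerivAt_id t).const_mul m)).deriv
    simp only [mul_one] at this
    exact (this.trans_ge (sub_nonneg.2 (hα t)))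
  have hcont : Continuous θ := continuous_iff_continuousAt.2 fun t => (hd t).continuousAt
  refine hcont.surjective ?_ ?_
  · refine tendsto_atTop_mono' (f₁ := fun t => m * t + θ 0) _ ?_
      (tendsto_atTop_add_const_right _ _ (tendsto_id.const_mul_atTop hm))
    filter_upwards [eventually_ge_atTop 0] with t ht
    have := hmono ht
    simp only [mul_zero, sub_zero] at this
    linarith
  · refine tendsto_atBot_mono' (f₁ := fun t => m * t + θ 0) _ ?_
      (tendsto_atBot_add_const_right _ _ (tendsto_id.const_mul_atBot hm))
    filter_upwards [eventually_le_atBot 0] with t ht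
    have := hmono ht
    simp only [mul_zero, sub_zero] at this
    linarith

theorem Function.Periodic.exists_pos_le {α : ℝ → ℝ} {S : ℝ} (hper : Function.Periodic α S)
    (hS : 0 < S) (hc : Continuous α) (hα : ∀ t, 0 < α t) : ∃ m > 0, ∀ t, m ≤ α t := by
  obtain ⟨t₀, -, hmin⟩ := (isCompact_Icc (a := 0) (b := S)).exists_isMinOn
    (nonempty_Icc.2 hS.le) hc.continuousOn
  refine ⟨α t₀, hα t₀, fun t => ?_⟩
  obtain ⟨s, hs, hst⟩ := hper.exists_mem_Ico₀ hS t
  exact hst ▸ hmin (Ico_subset_Icc_self hs)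

theorem exists_polar_sin_cos (u w : ℝ) :
    ∃ θ : ℝ, u = √(u ^ 2 + w ^ 2) * Real.sin θ ∧ w = √(u ^ 2 + w ^ 2) * Real.cos θ := by
  -- The angle is measured from the `w`-axis, so that it increases along the flow and `u` is the
  -- sine component.
  refine ⟨Complex.arg ⟨w, u⟩, ?_⟩
  have hn : ‖(⟨w, u⟩ : ℂ)‖ = √(u ^ 2 + w ^ 2) := by
    rw [Complex.norm_def, Complex.normSq_mk]; congr 1; ring
  rw [← hn, Complex.norm_mul_sin_arg, Complex.norm_mul_cos_arg]
  exact ⟨rfl, rfl⟩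

/-! ### Flows along circles and their periods -/

namespace LienardType

/-- Solutions of `u' = w / h(u)`, `w' = -u / h(u)`, whose orbits are circular arcs. -/
structure IsCircleFlow (J : Set ℝ) (h u w : ℝ → ℝ) : Prop where
  mem : ∀ t, u t ∈ J
  deriv_fst : ∀ t, HasDerivAt u (w t / h (u t)) t
  deriv_snd : ∀ t, HasDerivAt w (-(u t) / h (u t)) t

/-- The time at which the circle flow of radius `r` reaches the angle `s`. -/
noncomputable def timeOfAngle (h : ℝ → ℝ) (r s : ℝ) : ℝ := ∫ σ in (0 : ℝ)..s, h (r * Real.sin σ)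

variable {J : Set ℝ} {h u w : ℝ → ℝ} {r : ℝ}

/-- The angle is defined by integrating the speed `1 / h(u)`; the components of `(u, w)` in the
frame turned by this angle then have zero derivative, and are 0 and `r` at time 0. -/
theorem IsCircleFlow.exists_angle (hc : ContinuousOn h J) (hpos : ∀ v ∈ J, 0 < h v)
    (H : IsCircleFlow J h u w) (hr : r = √(u 0 ^ 2 + w 0 ^ 2)) :
    ∃ θ : ℝ → ℝ, (∀ t, HasDerivAt θ (1 / h (u t)) t) ∧ (∀ t, u t = r * Real.sin (θ t)) ∧
      ∀ t, w t = r * Real.cos (θ t) := by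
  have hucont : Continuous u := continuous_iff_continuousAt.2 fun t => (H.deriv_fst t).continuousAt
  have hαc : Continuous fun t => 1 / h (u t) :=
    continuous_const.div (hc.comp_continuous hucont H.mem) fun t => (hpos _ (H.mem t)).ne'
  obtain ⟨θ₀, hu0, hw0⟩ := exists_polar_sin_cos (u 0) (w 0)
  rw [← hr] at hu0 hw0
  let θ : ℝ → ℝ := fun t => θ₀ + ∫ s in (0 : ℝ)..t, 1 / h (u s)
  have hθ : ∀ t, HasDerivAt θ (1 / h (u t)) t := fun t =>
    (hαc.integral_hasStrictDerivAt 0 t).hasDerivAt.const_add θ₀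
  have hθ0 : θ 0 = θ₀ := by simp [θ]
  have hA : ∀ t, u t * Real.cos (θ t) - w t * Real.sin (θ t) = 0 := by
    have hd : ∀ t, HasDerivAt (fun t => u t * Real.cos (θ t) - w t * Real.sin (θ t)) 0 t := by
      intro t
      refine (((H.deriv_fst t).mul (hθ t).cos).sub
        ((H.deriv_snd t).mul (hθ t).sin)).congr_deriv ?_
      ring
    intro t
    have := is_const_of_deriv_eq_zero (fun t => (hd t).differentiableAt) (fun t => (hd t).deriv) t 0
    rw [this, hθ0]
    rw [hu0, hw0]; ring
  have hB : ∀ t, u t * Real.sin (θ t) + w t * Real.cos (θ t) = r := by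
    have hd : ∀ t, HasDerivAt (fun t => u t * Real.sin (θ t) + w t * Real.cos (θ t)) 0 t := by
      intro t
      refine (((H.deriv_fst t).mul (hθ t).sin).add
        ((H.deriv_snd t).mul (hθ t).cos)).congr_deriv ?_
      ring
    intro t
    have := is_const_of_deriv_eq_zero (fun t => (hd t).differentiableAt) (fun t => (hd t).deriv) t 0
    rw [this, hθ0]
    rw [hu0, hw0]
    linear_combination r * Real.sin_sq_add_cos_sq θ₀
  refine ⟨θ, hθ, fun t => ?_, fun t => ?_⟩
  · linear_combination Real.cos (θ t) * hA t + Real.sin (θ t) * hB t -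
      u t * Real.sin_sq_add_cos_sq (θ t)
  · linear_combination -Real.sin (θ t) * hA t + Real.cos (θ t) * hB t -
      w t * Real.sin_sq_add_cos_sq (θ t)

/-- Periodicity gives the angular speed a positive lower bound, so the angle takes every real value.
-/
theorem IsCircleFlow.Icc_subset (hc : ContinuousOn h J) (hpos : ∀ v ∈ J, 0 < h v)
    (H : IsCircleFlow J h u w) (hr : r = √(u 0 ^ 2 + w 0 ^ 2)) (hr0 : 0 < r) {S : ℝ} (hS : 0 < S)
    (hper : Function.Periodic u S) : Icc (-r) r ⊆ J := by
  obtain ⟨θ, hθ, hu, -⟩ := H.exists_angle hc hpos hr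
  have hucont : Continuous u := continuous_iff_continuousAt.2 fun t => (H.deriv_fst t).continuousAt
  have hαc : Continuous fun t => 1 / h (u t) :=
    continuous_const.div (hc.comp_continuous hucont H.mem) fun t => (hpos _ (H.mem t)).ne'
  obtain ⟨m, hm, hle⟩ := Function.Periodic.exists_pos_le (α := fun t => 1 / h (u t)) (S := S)
    (fun t => by simp only [hper t]) hS hαc fun t => one_div_pos.2 (hpos _ (H.mem t))
  have hsurj := surjective_of_hasDerivAt_ge hθ hm hle
  intro v hv
  obtain ⟨t, ht⟩ := hsurj (Real.arcsin (v / r))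
  have : u t = v := by
    rw [hu, ht, Real.sin_arcsin, mul_div_cancel₀ _ hr0.ne']
    · rw [le_div_iff₀ hr0]; linarith [hv.1]
    · rw [div_le_one hr0]; exact hv.2
  exact this ▸ H.mem t

theorem mul_sin_mem_Icc (hr0 : 0 ≤ r) (σ : ℝ) : r * Real.sin σ ∈ Icc (-r) r :=
  ⟨by nlinarith [Real.neg_one_le_sin σ], by nlinarith [Real.sin_le_one σ]⟩

theorem continuous_comp_mul_sin (hc : ContinuousOn h J) (hr0 : 0 ≤ r) (hJ : Icc (-r) r ⊆ J) :
    Continuous fun σ => h (r * Real.sin σ) :=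
  hc.comp_continuous (by fun_prop) fun σ => hJ (mul_sin_mem_Icc hr0 σ)

theorem hasDerivAt_timeOfAngle (hc : ContinuousOn h J) (hr0 : 0 ≤ r) (hJ : Icc (-r) r ⊆ J) (s : ℝ) :
    HasDerivAt (timeOfAngle h r) (h (r * Real.sin s)) s :=
  ((continuous_comp_mul_sin hc hr0 hJ).integral_hasStrictDerivAt 0 s).hasDerivAt

theorem strictMono_timeOfAngle (hc : ContinuousOn h J) (hpos : ∀ v ∈ J, 0 < h v) (hr0 : 0 ≤ r)
    (hJ : Icc (-r) r ⊆ J) : StrictMono (timeOfAngle h r) :=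
  strictMono_of_hasDerivAt_pos (hasDerivAt_timeOfAngle hc hr0 hJ)
    fun σ => hpos _ (hJ (mul_sin_mem_Icc hr0 σ))

theorem timeOfAngle_add_two_pi (hc : ContinuousOn h J) (hr0 : 0 ≤ r) (hJ : Icc (-r) r ⊆ J)
    (s : ℝ) : timeOfAngle h r (s + 2 * Real.pi) =
      timeOfAngle h r s + timeOfAngle h r (2 * Real.pi) := by
  have hk := continuous_comp_mul_sin hc hr0 hJ
  have hper : Function.Periodic (fun σ => h (r * Real.sin σ)) (2 * Real.pi) := fun σ => by
    simp only [Real.sin_add_two_pi]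
  have h1 := hper.intervalIntegral_add_eq s 0
  rw [zero_add] at h1
  unfold timeOfAngle
  rw [← intervalIntegral.integral_add_adjacent_intervals (hk.intervalIntegrable 0 s)
    (hk.intervalIntegrable s _), h1]

theorem timeOfAngle_two_pi (hc : ContinuousOn h J) (hr0 : 0 ≤ r) (hJ : Icc (-r) r ⊆ J) :
    timeOfAngle h r (2 * Real.pi) =
      2 * ∫ σ in (-(Real.pi / 2))..(Real.pi / 2), h (r * Real.sin σ) := by
  have hk := continuous_comp_mul_sin hc hr0 hJ
  have hper : Function.Periodic (fun σ => h (r * Real.sin σ)) (2 * Real.pi) := fun σ => by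
    simp only [Real.sin_add_two_pi]
  have h1 := hper.intervalIntegral_add_eq 0 (-(Real.pi / 2))
  rw [zero_add] at h1
  have h2 : ∫ σ in (Real.pi / 2)..(-(Real.pi / 2) + 2 * Real.pi), h (r * Real.sin σ) =
      ∫ σ in (-(Real.pi / 2))..(Real.pi / 2), h (r * Real.sin σ) := by
    have := intervalIntegral.integral_comp_sub_left (a := Real.pi / 2)
      (b := -(Real.pi / 2) + 2 * Real.pi) (fun σ => h (r * Real.sin σ)) Real.pi
    simp only [Real.sin_pi_sub] at this
    rw [this]
    congr 1 <;> ring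
  unfold timeOfAngle
  rw [h1, ← intervalIntegral.integral_add_adjacent_intervals
    (hk.intervalIntegrable _ (Real.pi / 2)) (hk.intervalIntegrable _ _), h2]
  ring

/-- The periods of a periodic circle flow: the least one is the time of a full turn. -/
theorem IsCircleFlow.period (hc : ContinuousOn h J) (hpos : ∀ v ∈ J, 0 < h v)
    (H : IsCircleFlow J h u w) (hr : r = √(u 0 ^ 2 + w 0 ^ 2)) (hr0 : 0 < r)
    (hJ : Icc (-r) r ⊆ J) :
    Function.Periodic u (timeOfAngle h r (2 * Real.pi)) ∧
    Function.Periodic w (timeOfAngle h r (2 * Real.pi)) ∧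
    ∀ S, 0 < S → Function.Periodic u S → Function.Periodic w S →
      timeOfAngle h r (2 * Real.pi) ≤ S := by
  obtain ⟨θ, hθ, hu, hw⟩ := H.exists_angle hc hpos hr
  have hmono := strictMono_timeOfAngle hc hpos hr0.le hJ
  -- `timeOfAngle` inverts the angle up to a time shift, hence the time `timeOfAngle h r (2π)` adds
  -- exactly one turn.
  have hτθ : ∀ t, timeOfAngle h r (θ t) = t + timeOfAngle h r (θ 0) := by
    have hd : ∀ t, HasDerivAt (fun t => timeOfAngle h r (θ t) - t) 0 t := by
      intro t
      refine (((hasDerivAt_timeOfAngle hc hr0.le hJ (θ t)).comp t (hθ t)).sub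
        (hasDerivAt_id t)).congr_deriv ?_
      rw [← hu t, mul_one_div_cancel (hpos _ (H.mem t)).ne', sub_self]
    intro t
    have := is_const_of_deriv_eq_zero (fun t => (hd t).differentiableAt) (fun t => (hd t).deriv) t 0
    linarith
  have hturn : ∀ t, θ (t + timeOfAngle h r (2 * Real.pi)) = θ t + 2 * Real.pi := by
    intro t
    apply hmono.injective
    rw [timeOfAngle_add_two_pi hc hr0.le hJ, hτθ, hτθ t]
    ring
  refine ⟨fun t => ?_, fun t => ?_, fun S hS hSu hSw => ?_⟩
  · rw [hu, hturn, Real.sin_add_two_pi, ← hu]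
  · rw [hw, hturn, Real.cos_add_two_pi, ← hw]
  · have hs : Real.sin (θ S) = Real.sin (θ 0) := by
      have := hSu 0
      rw [zero_add, hu, hu] at this
      exact mul_left_cancel₀ hr0.ne' this
    have hcs : Real.cos (θ S) = Real.cos (θ 0) := by
      have := hSw 0
      rw [zero_add, hw, hw] at this
      exact mul_left_cancel₀ hr0.ne' this
    have hθmono := strictMono_of_hasDerivAt_pos hθ fun t => one_div_pos.2 (hpos _ (H.mem t))
    -- A period turns the angle by `2πk`; `k ≥ 1` because the angle increases.
    obtain ⟨k, hk⟩ := Real.Angle.angle_eq_iff_two_pi_dvd_sub.1 (Real.Angle.cos_sin_inj hcs hs)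
    have hk0 : (0 : ℝ) < k := by
      have := hθmono hS
      have h2 : 0 < 2 * Real.pi * k := by linarith
      exact pos_of_mul_pos_right h2 (by positivity)
    have hk1 : (1 : ℝ) ≤ k := by
      exact_mod_cast (Int.cast_pos.1 hk0 : 0 < k)
    have hle : θ 0 + 2 * Real.pi ≤ θ S := by nlinarith [Real.pi_pos]
    have := hmono.monotone hle
    rw [timeOfAngle_add_two_pi hc hr0.le hJ, hτθ S] at this
    linarith

/-- Circle flows exist along circles projecting into `J`. -/
theorem exists_isCircleFlow (hc : ContinuousOn h J) (hpos : ∀ v ∈ J, 0 < h v) (u₀ w₀ : ℝ)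
    (hJ : Icc (-√(u₀ ^ 2 + w₀ ^ 2)) (√(u₀ ^ 2 + w₀ ^ 2)) ⊆ J) :
    ∃ u w : ℝ → ℝ, IsCircleFlow J h u w ∧ u 0 = u₀ ∧ w 0 = w₀ := by
  obtain ⟨θ₀, hu0, hw0⟩ := exists_polar_sin_cos u₀ w₀
  have hr0 : 0 ≤ √(u₀ ^ 2 + w₀ ^ 2) := Real.sqrt_nonneg _
  generalize √(u₀ ^ 2 + w₀ ^ 2) = r at hJ hu0 hw0 hr0
  have hτ := hasDerivAt_timeOfAngle hc hr0 hJ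
  have hmono := strictMono_timeOfAngle hc hpos hr0 hJ
  have hk := continuous_comp_mul_sin hc hr0 hJ
  have hkpos : ∀ σ, 0 < h (r * Real.sin σ) := fun σ => hpos _ (hJ (mul_sin_mem_Icc hr0 σ))
  obtain ⟨m, hm, hle⟩ := Function.Periodic.exists_pos_le (α := fun σ => h (r * Real.sin σ))
    (S := 2 * Real.pi) (fun σ => by simp only [Real.sin_add_two_pi]) Real.two_pi_pos hk hkpos
  -- The inverse of the time-of-angle bijection is the angle as a function of time; the shift `t₀`
  -- puts the initial angle at `θ₀`.
  let e := hmono.orderIsoOfSurjective _ (surjective_of_hasDerivAt_ge hτ hm hle)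
  have hτe : ∀ t, timeOfAngle h r (e.symm t) = t := fun t => e.apply_symm_apply t
  have hΘ : ∀ t, HasDerivAt e.symm (h (r * Real.sin (e.symm t)))⁻¹ t := fun t =>
    (hτ (e.symm t)).of_local_left_inverse e.symm.continuous.continuousAt (hkpos _).ne'
      (Eventually.of_forall hτe)
  let t₀ := timeOfAngle h r θ₀
  have hshift : ∀ t, HasDerivAt (fun t => e.symm (t + t₀))
      (h (r * Real.sin (e.symm (t + t₀))))⁻¹ t := fun t => (hΘ (t + t₀)).comp_add_const t t₀
  have h0 : e.symm (0 + t₀) = θ₀ := by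
    rw [zero_add]; exact e.symm_apply_apply θ₀
  refine ⟨fun t => r * Real.sin (e.symm (t + t₀)), fun t => r * Real.cos (e.symm (t + t₀)),
    ⟨fun t => hJ (mul_sin_mem_Icc hr0 _), fun t => ?_, fun t => ?_⟩, ?_, ?_⟩
  · refine ((hshift t).sin.const_mul r).congr_deriv ?_
    ring
  · refine ((hshift t).cos.const_mul r).congr_deriv ?_
    ring
  · simp only [h0, ← hu0]
  · simp only [h0, ← hw0]

end LienardType

/-! ### Analyticity of quotients and integrals -/

theorem AnalyticAt.dslope_same {k : ℝ → ℝ} {a : ℝ} (hk : AnalyticAt ℝ k a) :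
    AnalyticAt ℝ (dslope k a) a := by
  obtain ⟨p, hp⟩ := hk
  exact ⟨_, hp.has_fpower_series_dslope_fslope⟩

theorem hasDerivAt_integral_of_ordConnected {I : Set ℝ} (hI : IsOpen I) (hconn : I.OrdConnected)
    {k : ℝ → ℝ} (hk : ContinuousOn k I) {a x : ℝ} (ha : a ∈ I) (hx : x ∈ I) :
    HasDerivAt (fun x => ∫ s in a..x, k s) (k x) x :=
  intervalIntegral.integral_hasDerivAt_right
    ((hk.mono (hconn.uIcc_subset ha hx)).intervalIntegrable)
    (hk.stronglyMeasurableAtFilter hI x hx) (hk.continuousAt (hI.mem_nhds hx))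

theorem analyticOnNhd_integral_of_ordConnected {I : Set ℝ} (hI : IsOpen I)
    (hconn : I.OrdConnected) {k : ℝ → ℝ} (hk : AnalyticOnNhd ℝ k I) {a : ℝ} (ha : a ∈ I) :
    AnalyticOnNhd ℝ (fun x => ∫ s in a..x, k s) I := fun x hx =>
  (hk x hx).of_hasDerivAt <| (hI.eventually_mem hx).mono fun _ hy =>
    hasDerivAt_integral_of_ordConnected hI hconn hk.continuousOn ha hy

/-- Equality of two real numbers of the same sign from that of their squares. -/
theorem eq_of_sq_eq_sq_of_mul_pos {x y : ℝ} (h : x ^ 2 = y ^ 2) (hxy : 0 < x * y) : x = y := by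
  rcases sq_eq_sq_iff_eq_or_eq_neg.1 h with h | h
  · exact h
  · subst h; nlinarith [sq_nonneg y]

/-! ### The potential and its double zero at the origin -/

namespace LienardType

/-- The potential `∫₀ˣ g e^{2F}`. -/
noncomputable def potential (f g : ℝ → ℝ) (x : ℝ) : ℝ :=
  ∫ s in (0 : ℝ)..x, g s * Real.exp (2 * primF f s)

/-- The standing hypotheses on the coefficients of the equation. -/
structure Admissible (I : Set ℝ) (f g : ℝ → ℝ) : Prop where
  isOpen : IsOpen I
  ordConnected : I.OrdConnected
  zero_mem : (0 : ℝ) ∈ I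
  analytic_f : AnalyticOnNhd ℝ f I
  analytic_g : AnalyticOnNhd ℝ g I
  sign : ∀ x ∈ I, x ≠ 0 → 0 < x * g x
  deriv_pos : 0 < deriv g 0

namespace Admissible

variable {I : Set ℝ} {f g X H : ℝ → ℝ} (A : Admissible I f g)
include A

theorem hasDerivAt_primF {x : ℝ} (hx : x ∈ I) : HasDerivAt (primF f) (f x) x :=
  hasDerivAt_integral_of_ordConnected A.isOpen A.ordConnected A.analytic_f.continuousOn A.zero_mem hx

theorem analytic_primF : AnalyticOnNhd ℝ (primF f) I :=
  analyticOnNhd_integral_of_ordConnected A.isOpen A.ordConnected A.analytic_f A.zero_mem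

theorem analytic_exp_primF : AnalyticOnNhd ℝ (fun x => Real.exp (primF f x)) I :=
  A.analytic_primF.rexp

theorem hasDerivAt_phi {x : ℝ} (hx : x ∈ I) : HasDerivAt (phi f) (Real.exp (primF f x)) x :=
  hasDerivAt_integral_of_ordConnected A.isOpen A.ordConnected A.analytic_exp_primF.continuousOn
    A.zero_mem hx

theorem analytic_phi : AnalyticOnNhd ℝ (phi f) I :=
  analyticOnNhd_integral_of_ordConnected A.isOpen A.ordConnected A.analytic_exp_primF A.zero_mem

theorem analytic_force : AnalyticOnNhd ℝ (fun x => g x * Real.exp (2 * primF f x)) I :=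
  A.analytic_g.mul (analyticOnNhd_const.mul A.analytic_primF).rexp

theorem hasDerivAt_potential {x : ℝ} (hx : x ∈ I) :
    HasDerivAt (potential f g) (g x * Real.exp (2 * primF f x)) x :=
  hasDerivAt_integral_of_ordConnected A.isOpen A.ordConnected A.analytic_force.continuousOn
    A.zero_mem hx

theorem analytic_potential : AnalyticOnNhd ℝ (potential f g) I :=
  analyticOnNhd_integral_of_ordConnected A.isOpen A.ordConnected A.analytic_force A.zero_mem

/-- The product `x g(x)` has a local minimum at 0, where its derivative is `g 0`. -/
theorem g_zero : g 0 = 0 := by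
  have hc : ContinuousAt (fun x => x * g x) 0 :=
    continuousAt_id.mul (A.analytic_g 0 A.zero_mem).continuousAt
  have hmin : IsLocalMin (fun x => x * g x) 0 := by
    filter_upwards [A.isOpen.mem_nhds A.zero_mem] with x hx
    rw [zero_mul]
    by_cases h : x = 0
    · simp [h]
    · exact (A.sign x hx h).le
  have hd := (hasDerivAt_id (0 : ℝ)).mul
    (A.analytic_g 0 A.zero_mem).differentiableAt.hasDerivAt
  simpa using hmin.hasDerivAt_eq_zero hd

/-- Makes the sign conditions `X φ > 0` and `x X > 0` interchangeable. -/
theorem phi_pos {x : ℝ} (hx : x ∈ I) (h : x ≠ 0) : 0 < x * phi f x := by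
  have hmono : StrictMonoOn (phi f) I := by
    refine strictMonoOn_of_deriv_pos A.ordConnected.convex A.analytic_phi.continuousOn fun y hy => ?_
    rw [(A.hasDerivAt_phi (interior_subset hy)).deriv]
    exact Real.exp_pos _
  have h0 : phi f 0 = 0 := by simp [phi]
  rcases lt_or_gt_of_ne h with h | h
  · exact mul_pos_of_neg_of_neg h (h0 ▸ hmono hx A.zero_mem h)
  · exact mul_pos h (h0 ▸ hmono A.zero_mem hx h)

theorem potential_pos {x : ℝ} (hx : x ∈ I) (h : x ≠ 0) : 0 < potential f g x := by
  have hint := (A.analytic_force.continuousOn.mono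
    (A.ordConnected.uIcc_subset A.zero_mem hx)).intervalIntegrable (μ := MeasureTheory.volume)
  unfold potential
  rcases lt_or_gt_of_ne h with h | h
  · rw [intervalIntegral.integral_symm, ← intervalIntegral.integral_neg]
    refine intervalIntegral.intervalIntegral_pos_of_pos_on hint.symm.neg (fun s hs => ?_) h
    have := A.sign s (A.ordConnected.out hx A.zero_mem ⟨hs.1.le, hs.2.le⟩) hs.2.ne
    have hg : 0 < -g s := neg_pos.2 (neg_of_mul_pos_right this hs.2.le)
    rw [← neg_mul]
    exact mul_pos hg (Real.exp_pos _)
  · refine intervalIntegral.intervalIntegral_pos_of_pos_on hint (fun s hs => ?_) h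
    have := A.sign s (A.ordConnected.out A.zero_mem hx ⟨hs.1.le, hs.2.le⟩) hs.1.ne'
    exact mul_pos (pos_of_mul_pos_right this hs.1.le) (Real.exp_pos _)

/-- The potential and its derivative vanish at 0, so `x` can be divided out twice; `g'(0) > 0` makes
the zero exactly double. -/
theorem exists_potential_eq_sq_mul :
    ∃ k : ℝ → ℝ, AnalyticAt ℝ k 0 ∧ 0 < k 0 ∧ ∀ x, potential f g x = x ^ 2 * k x := by
  have hG := A.analytic_potential 0 A.zero_mem
  have hk : AnalyticAt ℝ (dslope (dslope (potential f g) 0) 0) 0 := hG.dslope_same.dslope_same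
  have hq : AnalyticAt ℝ (dslope g 0) 0 := (A.analytic_g 0 A.zero_mem).dslope_same
  have hgq : ∀ x, g x = x * dslope g 0 x := fun x => by
    have := sub_smul_dslope g 0 x
    rw [A.g_zero, sub_zero, sub_zero, smul_eq_mul] at this
    exact this.symm
  have heq : ∀ x, potential f g x = x ^ 2 * dslope (dslope (potential f g) 0) 0 x := by
    intro x
    have h1 := sub_smul_dslope (potential f g) 0 x
    have h2 := sub_smul_dslope (dslope (potential f g) 0) 0 x
    have h3 : potential f g 0 = 0 := by simp [potential]
    rw [dslope_same, (A.hasDerivAt_potential A.zero_mem).deriv, A.g_zero] at h2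
    simp only [sub_zero, smul_eq_mul, zero_mul, h3] at h1 h2
    rw [pow_two, mul_assoc, h2, h1]
  set k := dslope (dslope (potential f g) 0) 0 with hkdef
  refine ⟨k, hk, ?_, heq⟩
  have hE : ContinuousAt (fun x => Real.exp (2 * primF f x)) 0 :=
    ((analyticAt_const.mul (A.analytic_primF 0 A.zero_mem)).rexp).continuousAt
  -- Differentiating `x² k` and dividing by `x ≠ 0` gives `2k + x k' = (g / x) e^{2F}`; letting `x →
  -- 0` yields `2 k(0) = g'(0) e^{2F(0)}`.
  have hl : Tendsto (fun x => 2 * k x + x * deriv k x) (𝓝[≠] 0) (𝓝 (2 * k 0 + 0 * deriv k 0)) :=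
    ((continuousAt_const.mul hk.continuousAt).add
      (continuousAt_id.mul hk.deriv.continuousAt)).tendsto.mono_left nhdsWithin_le_nhds
  have hr : Tendsto (fun x => dslope g 0 x * Real.exp (2 * primF f x)) (𝓝[≠] 0)
      (𝓝 (dslope g 0 0 * Real.exp (2 * primF f 0))) :=
    (hq.continuousAt.mul hE).tendsto.mono_left nhdsWithin_le_nhds
  have hlr : (fun x => 2 * k x + x * deriv k x) =ᶠ[𝓝[≠] 0]
      fun x => dslope g 0 x * Real.exp (2 * primF f x) := by
    filter_upwards [mem_nhdsWithin_of_mem_nhds (A.isOpen.mem_nhds A.zero_mem),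
      nhdsWithin_le_nhds hk.eventually_analyticAt, self_mem_nhdsWithin] with x hx hkx hx0
    have h1 : HasDerivAt (fun x => x ^ 2 * k x) (g x * Real.exp (2 * primF f x)) x :=
      (A.hasDerivAt_potential hx).congr_of_eventuallyEq (Eventually.of_forall fun y => (heq y).symm)
    have h2 := h1.unique ((hasDerivAt_pow 2 x).mul hkx.differentiableAt.hasDerivAt)
    rw [hgq x] at h2
    refine mul_left_cancel₀ (show x ≠ 0 from hx0) ?_
    push_cast at h2
    linear_combination -h2
  have := tendsto_nhds_unique (hl.congr' hlr) hr
  have hpos : 0 < dslope g 0 0 * Real.exp (2 * primF f 0) := by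
    rw [dslope_same]; exact mul_pos A.deriv_pos (Real.exp_pos _)
  linarith

end Admissible

/-! ### The functions `X` and `H` -/

/-- `X` is the square root of twice the potential that has the sign of its argument. -/
structure IsSignedRoot (I : Set ℝ) (f g X : ℝ → ℝ) : Prop where
  sq_eq : ∀ x ∈ I, X x ^ 2 = 2 * potential f g x
  sign : ∀ x ∈ I, x ≠ 0 → 0 < x * X x

section

variable {I : Set ℝ} {f g X H : ℝ → ℝ}

theorem Admissible.exists_isSignedRoot (A : Admissible I f g) :
    ∃ X : ℝ → ℝ, IsSignedRoot I f g X := by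
  refine ⟨fun x => SignType.sign x * √(2 * potential f g x), fun x hx => ?_, fun x hx h => ?_⟩
  · by_cases h : x = 0
    · simp [h, potential]
    · have hs : ((SignType.sign x : SignType) : ℝ) ^ 2 = 1 := by
        rcases lt_or_gt_of_ne h with h | h <;> simp [h]
      rw [mul_pow, hs, Real.sq_sqrt (mul_pos two_pos (A.potential_pos hx h)).le, one_mul]
  · have hp := Real.sqrt_pos.2 (mul_pos two_pos (A.potential_pos hx h))
    rcases lt_or_gt_of_ne h with h | h
    · simp only [sign_neg h, SignType.coe_neg_one]
      nlinarith
    · simp only [sign_pos h, SignType.coe_one, one_mul]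
      positivity

theorem Admissible.isSignedRoot_of_isXHPair (A : Admissible I f g) (P : IsXHPair I f g X H) :
    IsSignedRoot I f g X := by
  refine ⟨fun x hx => ?_, fun x hx h => ?_⟩
  · have := P.sq_eq x hx
    unfold potential
    linarith
  · have h1 := P.sign x hx h
    have h2 := A.phi_pos hx h
    have h3 : 0 < (x * X x) * phi f x ^ 2 := by nlinarith
    exact pos_of_mul_pos_left h3 (sq_nonneg _)

namespace IsSignedRoot

variable (A : Admissible I f g) (R : IsSignedRoot I f g X)
include A R

theorem map_zero : X 0 = 0 := by
  simpa [potential] using R.sq_eq 0 A.zero_mem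

/-- The factor is `√(2k)`, analytic since `k(0) > 0`. It removes the singularity of the square root
of the potential at 0. -/
theorem exists_analytic_pos_factor :
    ∃ ξ : ℝ → ℝ, AnalyticAt ℝ ξ 0 ∧ 0 < ξ 0 ∧ ∀ᶠ x in 𝓝 0, X x = x * ξ x := by
  obtain ⟨k, hk, hk0, heq⟩ := A.exists_potential_eq_sq_mul
  have hpos : ∀ᶠ x in 𝓝 0, 0 < k x := hk.continuousAt.eventually (lt_mem_nhds hk0)
  refine ⟨fun x => √(2 * k x), ?_, Real.sqrt_pos.2 (by linarith), ?_⟩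
  · exact ((Real.contDiffAt_sqrt (by positivity)).analyticAt).comp (analyticAt_const.mul hk)
  · filter_upwards [hpos, A.isOpen.mem_nhds A.zero_mem] with x hkx hx
    by_cases h : x = 0
    · rw [h, map_zero A R, zero_mul]
    · refine eq_of_sq_eq_sq_of_mul_pos ?_ ?_
      · rw [R.sq_eq x hx, heq, mul_pow, Real.sq_sqrt (by positivity)]
        ring
      · have := mul_pos (R.sign x hx h) (Real.sqrt_pos.2 (mul_pos two_pos hkx))
        linarith

theorem analytic : AnalyticOnNhd ℝ X I := by
  intro x hx
  by_cases h : x = 0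
  · obtain ⟨ξ, hξ, -, heq⟩ := exists_analytic_pos_factor A R
    exact h ▸ (analyticAt_id.mul hξ).congr (heq.mono fun y hy => hy.symm)
  · have hroot : AnalyticAt ℝ (fun y => √(2 * potential f g y)) x :=
      ((Real.contDiffAt_sqrt (mul_pos two_pos (A.potential_pos hx h)).ne').analyticAt).comp
        (f := fun y => 2 * potential f g y) (analyticAt_const.mul (A.analytic_potential x hx))
    rcases lt_or_gt_of_ne h with h | h
    · refine hroot.neg.congr ?_
      filter_upwards [A.isOpen.mem_nhds hx, gt_mem_nhds h] with y hy hy0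
      have := R.sign y hy hy0.ne
      rw [Pi.neg_apply, ← R.sq_eq y hy, Real.sqrt_sq_eq_abs, abs_of_neg (by nlinarith), neg_neg]
    · refine hroot.congr ?_
      filter_upwards [A.isOpen.mem_nhds hx, lt_mem_nhds h] with y hy hy0
      have := R.sign y hy hy0.ne'
      rw [← R.sq_eq y hy, Real.sqrt_sq_eq_abs, abs_of_pos (by nlinarith)]

theorem hasDerivAt {x : ℝ} (hx : x ∈ I) : HasDerivAt X (deriv X x) x :=
  (analytic A R x hx).differentiableAt.hasDerivAt

theorem mul_deriv {x : ℝ} (hx : x ∈ I) : X x * deriv X x = g x * Real.exp (2 * primF f x) := by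
  have h1 := ((A.hasDerivAt_potential hx).const_mul 2).congr_of_eventuallyEq
    (f₁ := fun y => X y ^ 2) ((A.isOpen.eventually_mem hx).mono fun y hy => R.sq_eq y hy)
  have h2 := h1.unique ((hasDerivAt A R hx).pow 2)
  push_cast at h2
  linear_combination -h2 / 2

/-- Away from 0 this follows from `X X' = g e^{2F}`. At 0 both sides of that identity vanish, and
`X'(0) = ξ(0)` is used instead. -/
theorem deriv_pos {x : ℝ} (hx : x ∈ I) : 0 < deriv X x := by
  by_cases h : x = 0
  · obtain ⟨ξ, hξ, hξ0, heq⟩ := exists_analytic_pos_factor A R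
    have := ((hasDerivAt_id (0 : ℝ)).mul
      hξ.differentiableAt.hasDerivAt).congr_of_eventuallyEq (f₁ := X) heq
    rw [h, this.deriv]
    simpa using hξ0
  · have h1 : 0 < (x * X x) * deriv X x := by
      rw [mul_assoc, mul_deriv A R hx, ← mul_assoc]
      exact mul_pos (A.sign x hx h) (Real.exp_pos _)
    exact pos_of_mul_pos_right h1 (R.sign x hx h).le

theorem strictMonoOn : StrictMonoOn X I :=
  strictMonoOn_of_deriv_pos A.ordConnected.convex (analytic A R).continuousOn
    fun _ hy => deriv_pos A R (interior_subset hy)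

theorem isOpen_image : IsOpen (X '' I) := by
  refine isOpen_iff_mem_nhds.2 ?_
  rintro _ ⟨x, hx, rfl⟩
  rw [← (analytic A R x hx).hasStrictDerivAt.map_nhds_eq (deriv_pos A R hx).ne']
  exact image_mem_map (A.isOpen.mem_nhds hx)

end IsSignedRoot

theorem Admissible.exists_isXHPair (A : Admissible I f g) :
    ∃ X H : ℝ → ℝ, IsXHPair I f g X H := by
  obtain ⟨X, R⟩ := A.exists_isSignedRoot
  refine ⟨X, fun v => phi f (Function.invFunOn X I v) - v, fun x hx => ?_, fun x hx h => ?_,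
    fun x hx => ?_⟩
  · have := R.sq_eq x hx
    unfold potential at this
    linarith
  · have h1 := R.sign x hx h
    have h2 := A.phi_pos hx h
    have h3 : 0 < (X x * phi f x) * x ^ 2 := by nlinarith
    exact pos_of_mul_pos_left h3 (sq_nonneg _)
  · rw [(R.strictMonoOn A).injOn.leftInvOn_invFunOn hx]
    ring

/-- `H ∘ X = φ - X` is analytic and `X' ≠ 0`, so `X` can be inverted analytically. -/
theorem Admissible.analytic_H (A : Admissible I f g) (P : IsXHPair I f g X H) :
    AnalyticOnNhd ℝ H (X '' I) := by
  have R := A.isSignedRoot_of_isXHPair P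
  rintro _ ⟨x, hx, rfl⟩
  refine (analyticAt_comp_iff_of_deriv_ne_zero (R.analytic A x hx) (R.deriv_pos A hx).ne').1 ?_
  refine ((A.analytic_phi x hx).sub (R.analytic A x hx)).congr ?_
  filter_upwards [A.isOpen.mem_nhds hx] with y hy
  simp [P.phi_eq y hy]

/-- The derivative of `φ = X + H(X)`. It gives `1 + H' > 0` on `X(I)` and the form of the system in
the new coordinates. -/
theorem Admissible.one_add_deriv_H_mul (A : Admissible I f g) (P : IsXHPair I f g X H) {x : ℝ}
    (hx : x ∈ I) : (1 + deriv H (X x)) * deriv X x = Real.exp (primF f x) := by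
  have R := A.isSignedRoot_of_isXHPair P
  have hH := (A.analytic_H P _ (mem_image_of_mem X hx)).differentiableAt.hasDerivAt
  have h1 := (R.hasDerivAt A hx).add (hH.comp x (R.hasDerivAt A hx))
  have h2 := h1.congr_of_eventuallyEq (f₁ := phi f)
    ((A.isOpen.eventually_mem hx).mono fun y hy => P.phi_eq y hy)
  rw [(A.hasDerivAt_phi hx).unique h2]
  ring

theorem Admissible.one_add_deriv_H_pos (A : Admissible I f g) (P : IsXHPair I f g X H) :
    ∀ v ∈ X '' I, 0 < 1 + deriv H v := by
  rintro _ ⟨x, hx, rfl⟩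
  refine pos_of_mul_pos_left ?_ ((A.isSignedRoot_of_isXHPair P).deriv_pos A hx).le
  exact A.one_add_deriv_H_mul P hx ▸ Real.exp_pos _

theorem Admissible.continuousOn_one_add_deriv_H (A : Admissible I f g) (P : IsXHPair I f g X H) :
    ContinuousOn (fun v => 1 + deriv H v) (X '' I) :=
  continuousOn_const.add (A.analytic_H P).deriv.continuousOn

end

end LienardType

/-! ### Monotonicity of the averages -/

/-- Averages of `h` over the projections of small circles increase with the radius where `h` is
strictly convex. -/
theorem exists_strictMonoOn_integral_mul_sin {h : ℝ → ℝ} (hh : AnalyticAt ℝ h 0)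
    (h2 : 0 < deriv (deriv h) 0) :
    ∃ δ > 0, StrictMonoOn
      (fun r => ∫ θ in (-(Real.pi / 2))..(Real.pi / 2), h (r * Real.sin θ)) (Ioo 0 δ) := by
  obtain ⟨δ, hδ, hball⟩ := Metric.eventually_nhds_iff_ball.1 (hh.eventually_analyticAt.and
    (hh.deriv.deriv.continuousAt.eventually (lt_mem_nhds h2)))
  have hneg : ∀ {v}, v ∈ Metric.ball (0 : ℝ) δ → -v ∈ Metric.ball (0 : ℝ) δ := fun hv => by
    simpa using hv
  have hd : ∀ v ∈ Metric.ball (0 : ℝ) δ, HasDerivAt h (deriv h v) v := fun v hv =>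
    (hball v hv).1.differentiableAt.hasDerivAt
  have hcont : ContinuousOn h (Metric.ball 0 δ) := fun v hv =>
    (hball v hv).1.continuousAt.continuousWithinAt
  have hmono : StrictMonoOn (deriv h) (Metric.ball 0 δ) :=
    strictMonoOn_of_deriv_pos (convex_ball _ _)
      (fun v hv => (hball v hv).1.deriv.continuousAt.continuousWithinAt)
      fun v hv => (hball v (interior_subset hv)).2
  have hmem : ∀ v ∈ Ico 0 δ, v ∈ Metric.ball (0 : ℝ) δ := fun v hv => by
    simp only [Metric.mem_ball, Real.dist_eq, sub_zero, abs_of_nonneg hv.1, hv.2]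
  have hed : ∀ v ∈ Ico 0 δ, HasDerivAt (fun v => h v + h (-v)) (deriv h v - deriv h (-v)) v := by
    intro v hv
    refine ((hd v (hmem v hv)).add
      ((hd (-v) (hneg (hmem v hv))).comp v (hasDerivAt_neg v))).congr_deriv ?_
    ring
  -- The derivative `h'(v) - h'(-v)` is positive for `v > 0` since `h'` is strictly increasing.
  have he : StrictMonoOn (fun v => h v + h (-v)) (Ico 0 δ) := by
    refine strictMonoOn_of_deriv_pos (convex_Ico _ _)
      (fun v hv => (hed v hv).continuousAt.continuousWithinAt) fun v hv => ?_
    rw [interior_Ico] at hv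
    have hv' := Ioo_subset_Ico_self hv
    rw [(hed v hv').deriv, sub_pos]
    exact hmono (hneg (hmem v hv')) (hmem v hv') (by linarith [hv.1])
  have hsub : ∀ r ∈ Ioo 0 δ, Icc (-r) r ⊆ Metric.ball 0 δ := fun r hr v hv => by
    rw [Metric.mem_ball, Real.dist_eq, sub_zero, abs_lt]
    exact ⟨by linarith [hv.1, hr.2], by linarith [hv.2, hr.2]⟩
  have hc : ∀ r ∈ Ioo 0 δ, Continuous fun θ => h (r * Real.sin θ) := fun r hr =>
    LienardType.continuous_comp_mul_sin hcont hr.1.le (hsub r hr)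
  have hcn : ∀ r ∈ Ioo 0 δ, Continuous fun θ => h (-(r * Real.sin θ)) := fun r hr => by
    simpa [Function.comp_def] using (hc r hr).comp continuous_neg
  have heven : ∀ r ∈ Ioo 0 δ, ∫ θ in (-(Real.pi / 2))..(Real.pi / 2), h (r * Real.sin θ) =
      ∫ θ in (0 : ℝ)..(Real.pi / 2), (h (r * Real.sin θ) + h (-(r * Real.sin θ))) := by
    intro r hr
    rw [intervalIntegral.integral_add ((hc r hr).intervalIntegrable _ _)
      ((hcn r hr).intervalIntegrable _ _), ← intervalIntegral.integral_add_adjacent_intervals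
      ((hc r hr).intervalIntegrable (-(Real.pi / 2)) 0) ((hc r hr).intervalIntegrable _ _),
      add_comm]
    congr 1
    have := intervalIntegral.integral_comp_neg (a := 0) (b := Real.pi / 2)
      fun θ => h (r * Real.sin θ)
    simp only [Real.sin_neg, mul_neg, neg_zero] at this
    exact this.symm
  refine ⟨δ, hδ, fun r hr s hs hrs => ?_⟩
  simp only [heven r hr, heven s hs]
  have hin : ∀ r ∈ Ioo 0 δ, ∀ θ ∈ Icc 0 (Real.pi / 2), r * Real.sin θ ∈ Ico 0 δ := by
    intro r hr θ hθ
    have h0 := Real.sin_nonneg_of_nonneg_of_le_pi hθ.1 (by linarith [hθ.2, Real.pi_pos])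
    have h1 := Real.sin_le_one θ
    exact ⟨mul_nonneg hr.1.le h0, by nlinarith [hr.1, hr.2]⟩
  -- The integrands agree at `θ = 0`; strict inequality at one point, here `θ = π/2`, suffices by
  -- continuity.
  refine intervalIntegral.integral_lt_integral_of_continuousOn_of_le_of_exists_lt
    Real.pi_div_two_pos ((hc r hr).add (hcn r hr)).continuousOn
    ((hc s hs).add (hcn s hs)).continuousOn (fun θ hθ => ?_)
    ⟨Real.pi / 2, right_mem_Icc.2 Real.pi_div_two_pos.le, ?_⟩
  · have hθ' := Ioc_subset_Icc_self hθ
    have h0 := Real.sin_nonneg_of_nonneg_of_le_pi hθ'.1 (by linarith [hθ'.2, Real.pi_pos])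
    exact he.monotoneOn (hin r hr θ hθ') (hin s hs θ hθ') (by nlinarith)
  · have := he ⟨hr.1.le, hr.2⟩ ⟨hs.1.le, hs.2⟩ hrs
    simpa using this

/-! ### Cycles of the planar system, their periods, and the center -/

namespace LienardType

section

variable {I : Set ℝ} {f g X H : ℝ → ℝ}

theorem two_mul_level (f X : ℝ → ℝ) (p : ℝ × ℝ) :
    2 * level f X p = X p.1 ^ 2 + (Real.exp (primF f p.1) * p.2) ^ 2 := by
  unfold level; ring

theorem Admissible.sqrt_level_pos_iff (A : Admissible I f g) (R : IsSignedRoot I f g X) {p : ℝ × ℝ}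
    (hp : p.1 ∈ I) : 0 < √(2 * level f X p) ↔ p ≠ 0 := by
  rw [Real.sqrt_pos, two_mul_level]
  constructor
  · rintro h rfl
    simp [R.map_zero A] at h
  · intro h
    by_cases h1 : p.1 = 0
    · have h2 : p.2 ≠ 0 := fun h2 => h (Prod.ext h1 h2)
      have := Real.exp_pos (primF f p.1)
      positivity
    · have : X p.1 ≠ 0 := fun h0 => by simpa [h0] using R.sign p.1 hp h1
      positivity

theorem Admissible.equilibrium_iff (A : Admissible I f g) {p : ℝ × ℝ} (hp : p.1 ∈ I) :
    p.2 = 0 ∧ g p.1 = 0 ↔ p = 0 := by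
  constructor
  · rintro ⟨h2, hg⟩
    refine Prod.ext ?_ h2
    by_contra h1
    simpa [hg] using A.sign p.1 hp h1
  · rintro rfl
    exact ⟨rfl, A.g_zero⟩

/-- The coordinates `(X(x), e^{F(x)} y)` straighten the orbits to circular arcs. -/
theorem IsSolution.isCircleFlow {γ : ℝ → ℝ × ℝ} (S : IsSolution I f g γ) (A : Admissible I f g)
    (P : IsXHPair I f g X H) :
    IsCircleFlow (X '' I) (fun v => 1 + deriv H v) (fun t => X (γ t).1)
      (fun t => Real.exp (primF f (γ t).1) * (γ t).2) := by
  have R := A.isSignedRoot_of_isXHPair P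
  have hfst : ∀ t, HasDerivAt (fun t => (γ t).1) (γ t).2 t := fun t => (S.hasDerivAt t).fst
  have hsnd : ∀ t, HasDerivAt (fun t => (γ t).2) (-g (γ t).1 - f (γ t).1 * (γ t).2 ^ 2) t :=
    fun t => (S.hasDerivAt t).snd
  refine ⟨fun t => mem_image_of_mem X (S.mem t), fun t => ?_, fun t => ?_⟩
  · refine ((R.hasDerivAt A (S.mem t)).comp t (hfst t)).congr_deriv ?_
    rw [eq_div_iff (A.one_add_deriv_H_pos P _ (mem_image_of_mem X (S.mem t))).ne']
    linear_combination (γ t).2 * A.one_add_deriv_H_mul P (S.mem t)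
  · refine ((((A.hasDerivAt_primF (S.mem t)).comp t (hfst t)).exp).mul (hsnd t)).congr_deriv ?_
    rw [eq_div_iff (A.one_add_deriv_H_pos P _ (mem_image_of_mem X (S.mem t))).ne']
    have h1 := A.one_add_deriv_H_mul P (S.mem t)
    have h2 := R.mul_deriv A (S.mem t)
    rw [two_mul, Real.exp_add] at h2
    have h3 := Real.exp_pos (primF f (γ t).1)
    simp only [Function.comp_apply]
    have hX' := R.deriv_pos A (S.mem t)
    refine mul_right_cancel₀ hX'.ne' ?_
    linear_combination (-g (γ t).1 * Real.exp (primF f (γ t).1)) * h1 + h2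

/-- `X` is injective on `I` and `e^F ≠ 0`, so the change of coordinates loses no information about
periods. -/
theorem IsSolution.periodic_iff {γ : ℝ → ℝ × ℝ} (S : IsSolution I f g γ) (A : Admissible I f g)
    (R : IsSignedRoot I f g X) (T : ℝ) :
    Function.Periodic γ T ↔ Function.Periodic (fun t => X (γ t).1) T ∧
      Function.Periodic (fun t => Real.exp (primF f (γ t).1) * (γ t).2) T := by
  constructor
  · intro h
    exact ⟨fun t => by simp only [h t], fun t => by simp only [h t]⟩
  · rintro ⟨h1, h2⟩ t
    have hx : (γ (t + T)).1 = (γ t).1 := (R.strictMonoOn A).injOn (S.mem _) (S.mem _) (h1 t)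
    have hy := h2 t
    simp only [hx] at hy
    exact Prod.ext hx (mul_left_cancel₀ (Real.exp_pos _).ne' hy)

/-- A circle flow is pulled back by `x = X⁻¹(u)`, `y = e^{-F(x)} w`. -/
theorem Admissible.exists_isSolution (A : Admissible I f g) (P : IsXHPair I f g X H) {p : ℝ × ℝ}
    (hp : p.1 ∈ I) (hJ : Icc (-√(2 * level f X p)) (√(2 * level f X p)) ⊆ X '' I) :
    ∃ γ : ℝ → ℝ × ℝ, IsSolution I f g γ ∧ γ 0 = p := by
  have R := A.isSignedRoot_of_isXHPair P
  rw [two_mul_level] at hJ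
  obtain ⟨u, w, C, hu0, hw0⟩ := exists_isCircleFlow (A.continuousOn_one_add_deriv_H P)
    (A.one_add_deriv_H_pos P) _ _ hJ
  let Y := Function.invFunOn X I
  have hYX : ∀ x ∈ I, Y (X x) = x := (R.strictMonoOn A).injOn.leftInvOn_invFunOn
  have hYmem : ∀ t, Y (u t) ∈ I := fun t => by
    obtain ⟨x, hx, hxu⟩ := C.mem t
    rw [← hxu, hYX x hx]; exact hx
  have hXY : ∀ t, X (Y (u t)) = u t := fun t => by
    obtain ⟨x, hx, hxu⟩ := C.mem t
    rw [← hxu, hYX x hx]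
  have hYd : ∀ t, HasDerivAt Y (deriv X (Y (u t)))⁻¹ (u t) := by
    intro t
    have := ((R.analytic A _ (hYmem t)).hasStrictDerivAt.to_local_left_inverse
      (R.deriv_pos A (hYmem t)).ne' ((A.isOpen.eventually_mem (hYmem t)).mono hYX)).hasDerivAt
    rwa [hXY] at this
  have hx : ∀ t, HasDerivAt (fun t => Y (u t)) (Real.exp (-primF f (Y (u t))) * w t) t := by
    intro t
    refine ((hYd t).comp t (C.deriv_fst t)).congr_deriv ?_
    have h1 := A.one_add_deriv_H_mul P (hYmem t)
    rw [hXY] at h1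
    rw [Real.exp_neg, ← h1, mul_inv]
    field_simp
  have hy : ∀ t, HasDerivAt (fun t => Real.exp (-primF f (Y (u t))) * w t)
      (-g (Y (u t)) - f (Y (u t)) * (Real.exp (-primF f (Y (u t))) * w t) ^ 2) t := by
    intro t
    have hF : HasDerivAt (fun t => primF f (Y (u t)))
        (f (Y (u t)) * (Real.exp (-primF f (Y (u t))) * w t)) t :=
      HasDerivAt.comp (h₂ := primF f) t (A.hasDerivAt_primF (hYmem t)) (hx t)
    refine (hF.fun_neg.exp.mul (C.deriv_snd t)).congr_deriv ?_
    have h1 := A.one_add_deriv_H_mul P (hYmem t)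
    have h2 := R.mul_deriv A (hYmem t)
    have hhpos := A.one_add_deriv_H_pos P _ (C.mem t)
    rw [hXY] at h1 h2
    rw [two_mul, Real.exp_add] at h2
    have hE := Real.exp_pos (primF f (Y (u t)))
    have hX' := R.deriv_pos A (hYmem t)
    -- The quotient of `X X' = g e^{2F}` by `h(X) X' = e^F`.
    have hu : u t / (1 + deriv H (u t)) = g (Y (u t)) * Real.exp (primF f (Y (u t))) := by
      rw [div_eq_iff hhpos.ne']
      refine mul_right_cancel₀ hX'.ne' ?_
      linear_combination h2 - g (Y (u t)) * Real.exp (primF f (Y (u t))) * h1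
    rw [neg_div, hu, Real.exp_neg]
    field_simp
    ring
  refine ⟨fun t => (Y (u t), Real.exp (-primF f (Y (u t))) * w t),
    ⟨hYmem, fun t => (hx t).prodMk (hy t)⟩, ?_⟩
  · have hY0 : Y (u 0) = p.1 := by rw [hu0, hYX _ hp]
    refine Prod.ext hY0 ?_
    simp only [hY0, hw0]
    rw [← mul_assoc, ← Real.exp_add, neg_add_cancel, Real.exp_zero, one_mul]

/-- If the circle of a point other than the origin projects into `X(I)`, the point lies on a cycle. -/
theorem Admissible.onCycle_of_Icc_subset (A : Admissible I f g) (P : IsXHPair I f g X H) {p : ℝ × ℝ}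
    (hp : p.1 ∈ I) (hp0 : p ≠ 0)
    (hJ : Icc (-√(2 * level f X p)) (√(2 * level f X p)) ⊆ X '' I) : OnCycle I f g p := by
  have R := A.isSignedRoot_of_isXHPair P
  obtain ⟨γ, S, hγ⟩ := A.exists_isSolution P hp hJ
  have hr0 := (A.sqrt_level_pos_iff R hp).2 hp0
  obtain ⟨h1, h2, -⟩ := (S.isCircleFlow A P).period (A.continuousOn_one_add_deriv_H P)
    (A.one_add_deriv_H_pos P) (by rw [hγ, two_mul_level]) hr0 hJ
  refine ⟨fun h => hp0 ((A.equilibrium_iff hp).1 h), _, ?_, γ, S, hγ,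
    (S.periodic_iff A R _).2 ⟨h1, h2⟩⟩
  have := strictMono_timeOfAngle (A.continuousOn_one_add_deriv_H P) (A.one_add_deriv_H_pos P)
    hr0.le hJ Real.two_pi_pos
  simpa [timeOfAngle] using this

theorem Admissible.period_of_onCycle (A : Admissible I f g) (P : IsXHPair I f g X H) {p : ℝ × ℝ}
    (hp : OnCycle I f g p) :
    Icc (-√(2 * level f X p)) (√(2 * level f X p)) ⊆ X '' I ∧
      periodFunction I f g p = 2 * ∫ θ in (-(Real.pi / 2))..(Real.pi / 2),
        (1 + deriv H (√(2 * level f X p) * Real.sin θ)) := by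
  have R := A.isSignedRoot_of_isXHPair P
  have hc := A.continuousOn_one_add_deriv_H P
  have hpos := A.one_add_deriv_H_pos P
  obtain ⟨hne, T, hT, γ, S, hγ, hper⟩ := hp
  have hpI : p.1 ∈ I := hγ ▸ S.mem 0
  have hr0 : 0 < √(2 * level f X p) :=
    (A.sqrt_level_pos_iff R hpI).2 fun h => hne ((A.equilibrium_iff hpI).2 h)
  have hJ := (S.isCircleFlow A P).Icc_subset hc hpos (by rw [hγ, two_mul_level]) hr0 hT
    ((S.periodic_iff A R T).1 hper).1
  refine ⟨hJ, ?_⟩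
  rw [← timeOfAngle_two_pi hc hr0.le hJ]
  refine IsLeast.csInf_eq ⟨⟨?_, γ, S, hγ, ?_⟩, ?_⟩
  · have := strictMono_timeOfAngle hc hpos hr0.le hJ Real.two_pi_pos
    simpa [timeOfAngle] using this
  · obtain ⟨h1, h2, -⟩ := (S.isCircleFlow A P).period hc hpos (by rw [hγ, two_mul_level]) hr0 hJ
    exact (S.periodic_iff A R _).2 ⟨h1, h2⟩
  -- The competing period may belong to another solution through `p`; the lower bound holds for
  -- every circle flow of this radius.
  · rintro T' ⟨hT', γ', S', hγ', hper'⟩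
    obtain ⟨-, -, h3⟩ := (S'.isCircleFlow A P).period hc hpos (by rw [hγ', two_mul_level]) hr0 hJ
    obtain ⟨h4, h5⟩ := (S'.periodic_iff A R _).1 hper'
    exact h3 T' hT' h4 h5

theorem Admissible.eventually_Icc_subset (A : Admissible I f g) (R : IsSignedRoot I f g X) :
    ∀ᶠ r in 𝓝 (0 : ℝ), Icc (-r) r ⊆ X '' I := by
  have h0 : X '' I ∈ 𝓝 (0 : ℝ) :=
    (R.isOpen_image A).mem_nhds ⟨0, A.zero_mem, R.map_zero A⟩
  obtain ⟨ε, hε, hball⟩ := Metric.mem_nhds_iff.1 h0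
  filter_upwards [gt_mem_nhds hε] with r hr v hv
  refine hball ?_
  rw [Metric.mem_ball, Real.dist_eq, sub_zero, abs_lt]
  exact ⟨by linarith [hv.1], by linarith [hv.2]⟩

/-- The radius `√(2c)` is continuous in the point and vanishes at the origin, so circles of nearby
points project into the open set `X(I)`. -/
theorem Admissible.isCenter (A : Admissible I f g) : IsCenter I f g := by
  obtain ⟨X, H, P⟩ := A.exists_isXHPair
  have R := A.isSignedRoot_of_isXHPair P
  refine ⟨A.zero_mem, A.g_zero, ?_⟩
  have hI : ∀ᶠ p in 𝓝 (0 : ℝ × ℝ), p.1 ∈ I :=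
    continuousAt_fst.eventually (A.isOpen.mem_nhds A.zero_mem)
  have hX : ContinuousAt (fun p : ℝ × ℝ => X p.1) 0 :=
    (R.analytic A 0 A.zero_mem).continuousAt.comp (x := (0 : ℝ × ℝ)) continuousAt_fst
  have hE : ContinuousAt (fun p : ℝ × ℝ => Real.exp (primF f p.1)) 0 :=
    (A.analytic_exp_primF 0 A.zero_mem).continuousAt.comp (x := (0 : ℝ × ℝ)) (f := Prod.fst)
      continuousAt_fst
  have hr : ContinuousAt (fun p : ℝ × ℝ => √(2 * level f X p)) 0 := by
    simp only [two_mul_level]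
    exact ((hX.pow 2).add ((hE.mul continuousAt_snd).pow 2)).sqrt
  have hr0 : √(2 * level f X 0) = 0 := by
    rw [two_mul_level]; simp [R.map_zero A]
  have hJ := hr.eventually (hr0.symm ▸ A.eventually_Icc_subset R)
  filter_upwards [nhdsWithin_le_nhds hI, nhdsWithin_le_nhds hJ, self_mem_nhdsWithin]
    with p hp hpJ hp0
  exact A.onCycle_of_Icc_subset P hp hp0 hpJ

theorem IsSignedRoot.sqrt_level_axis (R : IsSignedRoot I f g X) {a : ℝ}
    (ha : a ∈ I) (ha0 : 0 < a) : √(2 * level f X (a, 0)) = X a := by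
  rw [two_mul_level]
  simp [Real.sqrt_sq (pos_of_mul_pos_right (R.sign a ha ha0.ne') ha0.le).le]

/-! ### The period near the origin -/

/-- Near the origin, the cycles through the positive `x`-axis and their periods. -/
theorem Admissible.exists_period_axis (A : Admissible I f g) (P : IsXHPair I f g X H) {ρ : ℝ}
    (hρ : 0 < ρ) : ∃ δ > 0, (∀ a ∈ Ioo (0 : ℝ) δ, OnCycle I f g (a, 0)) ∧
      StrictMonoOn X (Ioo 0 δ) ∧ MapsTo X (Ioo 0 δ) (Ioo 0 ρ) ∧
      ∀ a ∈ Ioo (0 : ℝ) δ, periodFunction I f g (a, 0) =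
        2 * ∫ θ in (-(Real.pi / 2))..(Real.pi / 2), (1 + deriv H (X a * Real.sin θ)) := by
  have R := A.isSignedRoot_of_isXHPair P
  have hX : Tendsto X (𝓝 0) (𝓝 0) := by
    simpa [ContinuousAt, R.map_zero A] using (R.analytic A 0 A.zero_mem).continuousAt
  obtain ⟨δ, hδ, hball⟩ := Metric.eventually_nhds_iff_ball.1
    ((A.isOpen.eventually_mem A.zero_mem).and
      ((hX.eventually (A.eventually_Icc_subset R)).and (hX.eventually (gt_mem_nhds hρ))))
  have hmem : ∀ a ∈ Ioo 0 δ, a ∈ Metric.ball (0 : ℝ) δ := fun a ha => by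
    simp only [Metric.mem_ball, Real.dist_eq, sub_zero, abs_of_pos ha.1, ha.2]
  have hI : ∀ a ∈ Ioo 0 δ, a ∈ I := fun a ha => (hball a (hmem a ha)).1
  have hcyc : ∀ a ∈ Ioo (0 : ℝ) δ, OnCycle I f g (a, 0) := by
    intro a ha
    refine A.onCycle_of_Icc_subset P (hI a ha) (fun h => ha.1.ne' (congrArg Prod.fst h)) ?_
    rw [R.sqrt_level_axis (hI a ha) ha.1]
    exact (hball a (hmem a ha)).2.1
  refine ⟨δ, hδ, hcyc, (R.strictMonoOn A).mono hI, fun a ha => ⟨?_, (hball a (hmem a ha)).2.2⟩,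
    fun a ha => ?_⟩
  · exact pos_of_mul_pos_right (R.sign a (hI a ha) ha.1.ne') ha.1.le
  · have := (A.period_of_onCycle P (hcyc a ha)).2
    rwa [R.sqrt_level_axis (hI a ha) ha.1] at this

theorem iteratedDeriv_three_eq (H : ℝ → ℝ) :
    iteratedDeriv 3 H 0 = deriv (deriv fun v => 1 + deriv H v) 0 := by
  simp [iteratedDeriv_succ, deriv_const_add']

theorem Admissible.periodIncreases (A : Admissible I f g) (P : IsXHPair I f g X H)
    (h3 : 0 < iteratedDeriv 3 H 0) : PeriodIncreasesNearZero I f g := by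
  have R := A.isSignedRoot_of_isXHPair P
  have hH := (A.analytic_H P 0 ⟨0, A.zero_mem, R.map_zero A⟩).deriv
  rw [iteratedDeriv_three_eq] at h3
  obtain ⟨ρ, hρ, hmono⟩ := exists_strictMonoOn_integral_mul_sin (analyticAt_const.add hH) h3
  obtain ⟨δ, hδ, hcyc, hXm, hmaps, hper⟩ := A.exists_period_axis P hρ
  refine ⟨δ, hδ, hcyc, fun a ha b hb hab => ?_⟩
  simp only [hper a ha, hper b hb]
  exact mul_lt_mul_of_pos_left (hmono (hmaps ha) (hmaps hb) (hXm ha hb hab)) two_pos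

theorem Admissible.periodDecreases (A : Admissible I f g) (P : IsXHPair I f g X H)
    (h3 : iteratedDeriv 3 H 0 < 0) : PeriodDecreasesNearZero I f g := by
  have R := A.isSignedRoot_of_isXHPair P
  have hH := (A.analytic_H P 0 ⟨0, A.zero_mem, R.map_zero A⟩).deriv
  -- The increasing case is applied to `-h`, since the averaging lemma needs no sign of the function
  -- itself.
  have h3' : 0 < deriv (deriv fun v => -(1 + deriv H v)) 0 := by
    rw [iteratedDeriv_three_eq] at h3
    simp only [deriv.fun_neg']
    linarith
  obtain ⟨ρ, hρ, hmono⟩ := exists_strictMonoOn_integral_mul_sin (analyticAt_const.add hH).neg h3'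
  obtain ⟨δ, hδ, hcyc, hXm, hmaps, hper⟩ := A.exists_period_axis P hρ
  refine ⟨δ, hδ, hcyc, fun a ha b hb hab => ?_⟩
  have := hmono (hmaps ha) (hmaps hb) (hXm ha hb hab)
  simp only [Pi.neg_apply, Pi.add_apply, intervalIntegral.integral_neg] at this
  simp only [hper a ha, hper b hb]
  linarith

/-- The points `(a, 0)` with `a → 0+` lie eventually in any punctured neighborhood of the origin, so
a constant period would take equal values at two different `a`. -/
theorem Admissible.not_isochronous_of_injOn {δ : ℝ} (hδ : 0 < δ)
    (hinj : InjOn (fun a : ℝ => periodFunction I f g (a, 0)) (Ioo 0 δ)) :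
    ¬ IsIsochronousCenter I f g := by
  rintro ⟨-, τ, hτ⟩
  have hcont : Tendsto (fun a : ℝ => (a, (0 : ℝ))) (𝓝[>] 0) (𝓝[≠] (0 : ℝ × ℝ)) := by
    refine tendsto_nhdsWithin_iff.2 ⟨?_, ?_⟩
    · exact ((by fun_prop : Continuous fun a : ℝ => (a, (0 : ℝ))).tendsto 0).mono_left
        nhdsWithin_le_nhds
    · filter_upwards [self_mem_nhdsWithin] with a ha h
      exact (show (0 : ℝ) < a from ha).ne' (congrArg Prod.fst h)
  obtain ⟨ε, hε, hsub⟩ := mem_nhdsGT_iff_exists_Ioo_subset.1 (hcont.eventually hτ)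
  have hε' : (0 : ℝ) < ε := hε
  have hm : 0 < min δ ε := lt_min hδ hε'
  have hlt : ∀ c : ℝ, 0 < c → c < 1 → c * min δ ε ∈ Ioo 0 (min δ ε) := fun c h0 h1 =>
    ⟨by positivity, by nlinarith⟩
  have h1 := hlt (1 / 2) (by norm_num) (by norm_num)
  have h2 := hlt (1 / 3) (by norm_num) (by norm_num)
  have hδm : Ioo 0 (min δ ε) ⊆ Ioo 0 δ := Ioo_subset_Ioo_right (min_le_left _ _)
  have hεm : Ioo 0 (min δ ε) ⊆ Ioo 0 ε := Ioo_subset_Ioo_right (min_le_right _ _)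
  have := hinj (hδm h1) (hδm h2) ((hsub (hεm h1)).trans (hsub (hεm h2)).symm)
  linarith

end

end LienardType

theorem mainTheorem5 (I : Set ℝ) (hIopen : IsOpen I) (hIconn : I.OrdConnected) (hI0 : (0 : ℝ) ∈ I)
    (f g : ℝ → ℝ) (hf : AnalyticOnNhd ℝ f I) (hg : AnalyticOnNhd ℝ g I)
    (hsign : ∀ x ∈ I, x ≠ 0 → 0 < x * g x) (hg0 : 0 < deriv g 0) :
    LienardType.IsCenter I f g ∧
    (∃ X H : ℝ → ℝ, LienardType.IsXHPair I f g X H) ∧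
    ∀ X H : ℝ → ℝ, LienardType.IsXHPair I f g X H →
      AnalyticOnNhd ℝ H (X '' I) ∧
      (∀ p : ℝ × ℝ, LienardType.OnCycle I f g p →
        ∀ c : ℝ, c = LienardType.level f X p →
          Set.Icc (-√(2 * c)) (√(2 * c)) ⊆ X '' I ∧
          LienardType.periodFunction I f g p =
            2 * ∫ θ in (-(Real.pi / 2))..(Real.pi / 2), (1 + deriv H (√(2 * c) * Real.sin θ))) ∧
      (0 < iteratedDeriv 3 H 0 → LienardType.PeriodIncreasesNearZero I f g) ∧
      (iteratedDeriv 3 H 0 < 0 → LienardType.PeriodDecreasesNearZero I f g) ∧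
      (LienardType.IsIsochronousCenter I f g → iteratedDeriv 3 H 0 = 0) := by
  have A : LienardType.Admissible I f g := ⟨hIopen, hIconn, hI0, hf, hg, hsign, hg0⟩
  refine ⟨A.isCenter, A.exists_isXHPair, fun X H P => ⟨A.analytic_H P, ?_, A.periodIncreases P,
    A.periodDecreases P, fun hiso => ?_⟩⟩
  · rintro p hp c rfl
    exact A.period_of_onCycle P hp
  · rcases lt_trichotomy (iteratedDeriv 3 H 0) 0 with h | h | h
    · obtain ⟨δ, hδ, -, hmono⟩ := A.periodDecreases P h
      exact absurd hiso (LienardType.Admissible.not_isochronous_of_injOn hδ hmono.injOn)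
    · exact h
    · obtain ⟨δ, hδ, -, hmono⟩ := A.periodIncreases P h
      exact absurd hiso (LienardType.Admissible.not_isochronous_of_injOn hδ hmono.injOn)
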